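/- Let $X$ be a real or complex Banach space, let $A:D(A)\subset X\to X$ be a linear operator that generates a $C_0$-semigroup $(T(t))_{t\ge 0}$ on $X$, and let $f:X\to X$ be Fréchet differentiable on $X$ with derivative $Df$. Consider $$\dot z(t)=Az(t)+f(z(t)),\qquad z(0)=z_0, \tag{1}$$ where a solution on $[0,b]$ is a continuous $z:[0,b]\to X$ with $z(t)=T(t)z_0+\int_0^t T(t-s)f(z(s))\,ds$ for $0\le t\le b$. Let $z_e\in D(A)$ be an equilibrium, that is, $Az_e+f(z_e)=0$. Suppose that, for a continuous increasing (not necessarily strictly) function $c:[0,\infty)\to[0,\infty)$ and for some $r>\|z_e\|$ (in particular, if this holds for every $r>0$), $$\|Df(z_1)-Df(z_2)\|\le c(r)\,\|z_1-z_2\|\qquad\text{for all } \|z_1\|\le r,\ \|z_2\|\le r .$$ (i) If $A+Df(z_e)$, with domain $D(A)$, generates a $C_0$-semigroup $U(t)$ that is exponentially stable ($\|U(t)\|\le Me^{-\alpha t}$ for all $t\ge0$, for some constants $M$ and $\alpha>0$), then $z_e$ is a locally exponentially stable equilibrium of (1): there are $\delta>0$, $C$ and $\alpha'>0$ such that for every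 $z_0$ with $\|z_0-z_e\|<\delta$ equation (1) has a solution $z$ on $[0,\infty)$, it is unique on every interval $[0,b]$, and $\|z(t)-z_e\|\le Ce^{-\alpha' t}\|z_0-z_e\|$ for all $t\ge 0$. (ii) If $A+Df(z_e)$, with domain $D(A)$, generates a $C_0$-semigroup $U(t)$ that is unstable, in the sense that its growth bound $$\omega_0(U)=\inf\{\omega\in\mathbb R:\ \exists M\ \forall t\ge0\ \ \|U(t)\|\le Me^{\omega t}\}$$ is positive, then $z_e$ is an unstable equilibrium of (1): there is $\varepsilon>0$ such that for every $\delta>0$ there are $z_0$ with $\|z_0-z_e\|<\delta$, a time $b\ge0$ and a solution $z$ of (1) on $[0,b]$ with $z(0)=z_0$ and $\|z(b)-z_e\|\ge\varepsilon$. -/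

import Mathlib

open Set Filter Topology
open scoped NNReal

/-- A `C₀`-semigroup of bounded linear operators on `X`. The family is indexed by `ℝ` for
convenience; only its values at times `t ≥ 0` matter. -/
structure IsC0Semigroup {𝕜 X : Type*} [RCLike 𝕜] [NormedAddCommGroup X] [NormedSpace 𝕜 X]
    (T : ℝ → X →L[𝕜] X) : Prop where
  map_zero : T 0 = ContinuousLinearMap.id 𝕜 X
  map_add : ∀ s t : ℝ, 0 ≤ s → 0 ≤ t → T (s + t) = (T s).comp (T t)
  tendsto_zero : ∀ x : X, Tendsto (fun t : ℝ => T t x) (𝓝[>] 0) (𝓝 x)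

/-- The (in general unbounded) linear operator `A : D(A) ⊆ X → X` is the generator of the
`C₀`-semigroup `T`: the pair `(x, y)` is in the graph of `A` if and only if
`(T(t)x - x) / t → y` as `t → 0+`. -/
structure GeneratesC0Semigroup {𝕜 X : Type*} [RCLike 𝕜] [NormedAddCommGroup X]
    [NormedSpace ℝ X] [NormedSpace 𝕜 X]
    (A : X →ₗ.[𝕜] X) (T : ℝ → X →L[𝕜] X) : Prop where
  isC0Semigroup : IsC0Semigroup T
  mem_graph_iff : ∀ x y : X,
    (x, y) ∈ A.graph ↔ Tendsto (fun t : ℝ => t⁻¹ • (T t x - x)) (𝓝[>] 0) (𝓝 y)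

/-- Exponential stability of a semigroup of bounded linear operators. -/
def IsExponentiallyStable {𝕜 X : Type*} [RCLike 𝕜] [NormedAddCommGroup X] [NormedSpace 𝕜 X]
    (U : ℝ → X →L[𝕜] X) : Prop :=
  ∃ M α : ℝ, 0 < α ∧ ∀ t : ℝ, 0 ≤ t → ‖U t‖ ≤ M * Real.exp (-α * t)

/-- The growth bound `ω₀(U) ∈ [-∞, ∞]`: the infimum of all real `ω` such that
`‖U(t)‖ ≤ M e^{ωt}` for all `t ≥ 0`, with some constant `M`. -/
noncomputable def growthBound {𝕜 X : Type*} [RCLike 𝕜] [NormedAddCommGroup X] [NormedSpace 𝕜 X]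
    (U : ℝ → X →L[𝕜] X) : EReal :=
  sInf ((fun ω : ℝ => (ω : EReal)) ''
    {ω : ℝ | ∃ M : ℝ, ∀ t : ℝ, 0 ≤ t → ‖U t‖ ≤ M * Real.exp (ω * t)})

/-- Instability of a linear `C₀`-semigroup, i.e. exponential growth of its norm: the growth
bound is positive. -/
def IsUnstableSemigroup {𝕜 X : Type*} [RCLike 𝕜] [NormedAddCommGroup X] [NormedSpace 𝕜 X]
    (U : ℝ → X →L[𝕜] X) : Prop :=
  0 < growthBound U

/-- `z` is a (mild) solution on `[0, b]` of `ż = Az + f(z)`, `z(0) = z₀`, where `T` is the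
semigroup generated by `A`:  `z(t) = T(t) z₀ + ∫₀ᵗ T(t - s) f(z(s)) ds`. -/
def IsMildSolutionOn {𝕜 X : Type*} [RCLike 𝕜] [NormedAddCommGroup X]
    [NormedSpace ℝ X] [NormedSpace 𝕜 X]
    (T : ℝ → X →L[𝕜] X) (f : X → X) (b : ℝ) (z₀ : X) (z : ℝ → X) : Prop :=
  ContinuousOn z (Icc 0 b) ∧
    ∀ t ∈ Icc (0 : ℝ) b, z t = T t z₀ + ∫ s in (0 : ℝ)..t, T (t - s) (f (z s))

/-- `z_e` is an equilibrium of `ż = Az + f(z)`. -/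
def IsEquilibrium {𝕜 X : Type*} [RCLike 𝕜] [NormedAddCommGroup X] [NormedSpace 𝕜 X]
    (A : X →ₗ.[𝕜] X) (f : X → X) (z_e : X) : Prop :=
  ∃ h : z_e ∈ A.domain, A ⟨z_e, h⟩ + f z_e = 0

/-- Local exponential stability of `z_e`: every initial state `z₀` close to `z_e` has a solution
on `[0, ∞)`, unique on every interval `[0, b]`, and
`‖z(t) - z_e‖ ≤ C e^{-αt} ‖z₀ - z_e‖` with `C` and `α > 0` independent of `z₀`. -/
def IsLocallyExponentiallyStable {𝕜 X : Type*} [RCLike 𝕜] [NormedAddCommGroup X]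
    [NormedSpace ℝ X] [NormedSpace 𝕜 X]
    (T : ℝ → X →L[𝕜] X) (f : X → X) (z_e : X) : Prop :=
  ∃ δ C α : ℝ, 0 < δ ∧ 0 < α ∧ ∀ z₀ : X, ‖z₀ - z_e‖ < δ →
    ∃ z : ℝ → X, (∀ b : ℝ, IsMildSolutionOn T f b z₀ z) ∧
      (∀ (b : ℝ) (w : ℝ → X), IsMildSolutionOn T f b z₀ w → EqOn w z (Icc 0 b)) ∧
      ∀ t : ℝ, 0 ≤ t → ‖z t - z_e‖ ≤ C * Real.exp (-α * t) * ‖z₀ - z_e‖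

/-- Instability of `z_e` for the nonlinear system (the negation of Lyapunov stability): there is
`ε > 0` such that arbitrarily close to `z_e` a solution starts that reaches distance at least
`ε` from `z_e`. -/
def IsUnstableEquilibrium {𝕜 X : Type*} [RCLike 𝕜] [NormedAddCommGroup X]
    [NormedSpace ℝ X] [NormedSpace 𝕜 X]
    (T : ℝ → X →L[𝕜] X) (f : X → X) (z_e : X) : Prop :=
  ∃ ε : ℝ, 0 < ε ∧ ∀ δ : ℝ, 0 < δ → ∃ z₀ : X, ‖z₀ - z_e‖ < δ ∧
    ∃ (b : ℝ) (z : ℝ → X), 0 ≤ b ∧ IsMildSolutionOn T f b z₀ z ∧ ε ≤ ‖z b - z_e‖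

/-- The operator `A + Df(z)` with domain `D(A)`. -/
noncomputable def linearizedOperator {𝕜 X : Type*} [RCLike 𝕜] [NormedAddCommGroup X]
    [NormedSpace 𝕜 X] (A : X →ₗ.[𝕜] X) (f : X → X) (z : X) : X →ₗ.[𝕜] X :=
  (fderiv 𝕜 f z : X →ₗ[𝕜] X) +ᵥ A

/-!
The proof works over `ℝ` and in semigroup form. With `B = Df(z_e)`, let `T` and `U` be the
semigroups generated by `A` and `A + B`. Variation of constants gives
`U(t) x - T(t) x = ∫₀ᵗ T(t - s) B U(s) x ds`, first on the domain of the generator, where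
`s ↦ T(t - s) U(s) x` has right derivative `T(t - s) B U(s) x`, and then everywhere by density
(`integral_convolution_perturbation`). Together with Fubini's theorem on a triangle it shows that
`z_e + x` solves the original equation as soon as
`x(t) = U(t) x₀ + ∫₀ᵗ U(t - s) g(x(s)) ds`, where `g(x) = f(z_e + x) - f(z_e) - B x` is the
remainder of the linearization (`mild_of_perturbed_mild`). The Lipschitz bound on `Df` makes `g`
quadratically small near `0`.

Solutions of the last equation are found as fixed points of a contraction in a sup norm with
exponential weight `exp (β (t - n))` (`exists_small_fixedPoint`). It suffices that
`‖U(t)‖ ≤ M exp (ω t)` with `ω < 2 β`: the quadratic remainder produces the square of the weight,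
which dominates `exp (ω t)`. The solution found stays within half the amplitude of the linear
orbit `U(t) x₀`.

* Stability: with `ω = -α` and `β = -α / 4` the weight decays on `[0, ∞)`, and every small `x₀` is
  admissible. Uniqueness is Grönwall's inequality up to the first exit from the ball where `f` is
  Lipschitz (`IsMildSolutionOn.eqOn`).
* Instability: let `ω₀ > 0` be the growth bound of `U` and take `β < ω₀ < ω < 2 β`. Since
  `‖U(t)‖ exp (-β t)` is unbounded, there are `v` in the unit ball and a time `N` at which
  `‖U(N) v‖ exp (-β N)` is as large as desired. If `n` maximizes `‖U(t) v‖ exp (-β t)` on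
  `[0, N]`, then `‖U(t) v‖ ≤ ‖U(n) v‖ exp (β (t - n))` for `t ≤ n`, and `‖U(n) v‖` is large
  (`IsC0Semigroup.exists_orbit_le`). Scaling `v` so that `‖U(n) x₀‖` equals a fixed small amplitude
  `a`, the nonlinear solution starts arbitrarily close to `z_e` and is at distance at least `a / 2`
  from it at time `n`. No spectral information on `A + B` is needed.
-/

/-! ### `C₀`-semigroups: growth and continuity -/

namespace IsC0Semigroup

variable {X : Type*} [NormedAddCommGroup X] [NormedSpace ℝ X] {T : ℝ → X →L[ℝ] X}

theorem tendsto_nhdsGE_zero (hT : IsC0Semigroup T) (x : X) :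
    Tendsto (fun t : ℝ => T t x) (𝓝[≥] 0) (𝓝 x) := by
  have h0 : T 0 x = x := by rw [hT.map_zero]; rfl
  rw [← Ioi_insert, nhdsWithin_insert, tendsto_sup]
  refine ⟨?_, hT.tendsto_zero x⟩
  rw [tendsto_pure_left]
  intro s hs
  rw [h0]
  exact mem_of_mem_nhds hs

theorem map_add_apply (hT : IsC0Semigroup T) {s t : ℝ} (hs : 0 ≤ s) (ht : 0 ≤ t) (x : X) :
    T (s + t) x = T s (T t x) := by
  rw [hT.map_add s t hs ht]; rfl

variable [CompleteSpace X]

/-- Local boundedness at `0`, by the uniform boundedness principle. -/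
theorem exists_norm_le_near_zero (hT : IsC0Semigroup T) :
    ∃ δ M : ℝ, 0 < δ ∧ ∀ t ∈ Icc 0 δ, ‖T t‖ ≤ M := by
  by_contra! H
  have H' : ∀ n : ℕ, ∃ t ∈ Icc (0 : ℝ) (1 / ((n : ℝ) + 1)), (n : ℝ) < ‖T t‖ := fun n =>
    H _ n (by positivity)
  choose u hu hn using H'
  have hu0 : Tendsto u atTop (𝓝[≥] 0) := by
    refine tendsto_nhdsWithin_iff.2 ⟨?_, Eventually.of_forall fun n => (hu n).1⟩
    exact squeeze_zero (fun n => (hu n).1) (fun n => (hu n).2)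
      tendsto_one_div_add_atTop_nhds_zero_nat
  obtain ⟨C, hC⟩ := banach_steinhaus (g := fun n : ℕ => T (u n)) fun x => by
    have h := ((hT.tendsto_nhdsGE_zero x).comp hu0).norm.bddAbove_range
    obtain ⟨C, hC⟩ := h
    exact ⟨C, fun n => hC ⟨n, rfl⟩⟩
  obtain ⟨n, hnC⟩ := exists_nat_gt C
  exact absurd (hC n) (not_le.2 (hnC.trans (hn n)))

theorem exists_norm_le_mul_exp (hT : IsC0Semigroup T) :
    ∃ M ω : ℝ, 1 ≤ M ∧ 0 ≤ ω ∧ ∀ t : ℝ, 0 ≤ t → ‖T t‖ ≤ M * Real.exp (ω * t) := by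
  obtain ⟨δ, M₀, hδ, hM₀⟩ := hT.exists_norm_le_near_zero
  set M := max M₀ 1 with hM
  have hM1 : 1 ≤ M := le_max_right _ _
  have hMp : 0 < M := by linarith
  have key : ∀ n : ℕ, ∀ t ∈ Icc (0 : ℝ) (n * δ), ‖T t‖ ≤ M ^ n := by
    intro n
    induction n with
    | zero =>
      rintro t ⟨h0, h1⟩
      have : t = 0 := le_antisymm (by simpa using h1) h0
      rw [this, hT.map_zero, pow_zero]
      exact ContinuousLinearMap.norm_id_le
    | succ n ih =>
      rintro t ⟨h0, h1⟩
      push_cast at h1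
      rcases le_total t δ with h | h
      · calc ‖T t‖ ≤ M := (hM₀ t ⟨h0, h⟩).trans (le_max_left _ _)
          _ = M ^ 1 := (pow_one M).symm
          _ ≤ M ^ (n + 1) := pow_le_pow_right₀ hM1 (by omega)
      · have e : T t = (T (t - δ)).comp (T δ) := by
          rw [← hT.map_add _ _ (by linarith) hδ.le, sub_add_cancel]
        rw [e, pow_succ]
        refine (ContinuousLinearMap.opNorm_comp_le _ _).trans ?_
        gcongr
        · exact ih _ ⟨by linarith, by linarith⟩
        · exact (hM₀ δ ⟨hδ.le, le_rfl⟩).trans (le_max_left _ _)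
  refine ⟨M, Real.log M / δ, hM1, div_nonneg (Real.log_nonneg hM1) hδ.le, fun t ht => ?_⟩
  have h1 : t ≤ ⌈t / δ⌉₊ * δ := by
    rw [← div_le_iff₀ hδ]; exact Nat.le_ceil _
  refine (key _ t ⟨ht, h1⟩).trans ?_
  have h2 : (⌈t / δ⌉₊ : ℝ) ≤ t / δ + 1 := (Nat.ceil_lt_add_one (by positivity)).le
  calc M ^ ⌈t / δ⌉₊ = Real.exp (Real.log M * ⌈t / δ⌉₊) := by
        rw [mul_comm, Real.exp_nat_mul, Real.exp_log hMp]
    _ ≤ Real.exp (Real.log M * (t / δ + 1)) := by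
        gcongr; exact Real.log_nonneg hM1
    _ = M * Real.exp (Real.log M / δ * t) := by
        rw [mul_add, Real.exp_add, mul_one, Real.exp_log hMp]; ring_nf

/-- Joint continuity of the semigroup action, with negative times cut off at `0`. -/
theorem continuous_uncurry (hT : IsC0Semigroup T) :
    Continuous fun p : ℝ × X => T (max p.1 0) p.2 := by
  obtain ⟨M, ω, hM, hω, hb⟩ := hT.exists_norm_le_mul_exp
  have hM0 : 0 ≤ M := by linarith
  -- the semigroup law reduces a difference of two times to the behaviour at time zero
  have h1 : ∀ s t : ℝ, 0 ≤ s → s ≤ t → ∀ y : X,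
      ‖T t y - T s y‖ ≤ M * Real.exp (ω * s) * ‖T (t - s) y - y‖ := by
    intro s t hs hst y
    have : T t y = T s (T (t - s) y) := by
      rw [← hT.map_add_apply hs (by linarith), add_sub_cancel]
    rw [this, ← map_sub]
    exact (ContinuousLinearMap.le_opNorm _ _).trans (by gcongr; exact hb s hs)
  have h2 : ∀ s t : ℝ, 0 ≤ s → 0 ≤ t → ∀ y : X,
      ‖T t y - T s y‖ ≤ M * Real.exp (ω * (s + t)) * ‖T |t - s| y - y‖ := by
    intro s t hs ht y
    rcases le_total s t with h | h
    · rw [abs_of_nonneg (by linarith)]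
      refine (h1 s t hs h y).trans ?_
      gcongr; linarith
    · rw [abs_of_nonpos (by linarith), norm_sub_rev, neg_sub]
      refine (h1 t s ht h y).trans ?_
      gcongr; linarith
  rw [continuous_iff_continuousAt]
  rintro ⟨s, y⟩
  rw [ContinuousAt, tendsto_iff_norm_sub_tendsto_zero]
  have hle : ∀ p : ℝ × X, ‖T (max p.1 0) p.2 - T (max s 0) y‖ ≤
      M * Real.exp (ω * max p.1 0) * ‖p.2 - y‖ + M * Real.exp (ω * (max s 0 + max p.1 0)) *
        ‖T |max p.1 0 - max s 0| y - y‖ := by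
    rintro ⟨t, x⟩
    have : T (max t 0) x - T (max s 0) y =
        T (max t 0) (x - y) + (T (max t 0) y - T (max s 0) y) := by
      rw [map_sub]; abel
    rw [this]
    refine (norm_add_le _ _).trans (add_le_add ?_ (h2 _ _ (le_max_right _ _) (le_max_right _ _) y))
    exact (ContinuousLinearMap.le_opNorm _ _).trans (by gcongr; exact hb _ (le_max_right _ _))
  refine squeeze_zero (fun p => norm_nonneg _) hle ?_
  have hc1 : Tendsto (fun p : ℝ × X => M * Real.exp (ω * max p.1 0) * ‖p.2 - y‖) (𝓝 (s, y))
      (𝓝 (M * Real.exp (ω * max s 0) * ‖y - y‖)) :=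
    (Continuous.tendsto (by fun_prop) (s, y))
  have hc2 : Tendsto (fun p : ℝ × X => M * Real.exp (ω * (max s 0 + max p.1 0))) (𝓝 (s, y))
      (𝓝 (M * Real.exp (ω * (max s 0 + max s 0)))) :=
    (Continuous.tendsto (by fun_prop) (s, y))
  have hc3 : Tendsto (fun p : ℝ × X => |max p.1 0 - max s 0|) (𝓝 (s, y)) (𝓝[≥] 0) := by
    refine tendsto_nhdsWithin_iff.2 ⟨?_, Eventually.of_forall fun p => mem_Ici.2 (abs_nonneg _)⟩
    have := (Continuous.tendsto (f := fun p : ℝ × X => |max p.1 0 - max s 0|) (by fun_prop) (s, y))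
    simpa using this
  have hc4 := (((hT.tendsto_nhdsGE_zero y).comp hc3).sub_const y).norm
  have := hc1.add (hc2.mul hc4)
  simpa using this

/-- Continuity of the semigroup action along continuous paths, with negative times cut off. -/
theorem continuous_comp (hT : IsC0Semigroup T) {Y : Type*} [TopologicalSpace Y] {τ : Y → ℝ}
    {h : Y → X} (hτ : Continuous τ) (hh : Continuous h) :
    Continuous fun p => T (max (τ p) 0) (h p) :=
  hT.continuous_uncurry.comp (hτ.prodMk hh)

theorem continuousOn_apply (hT : IsC0Semigroup T) (x : X) :
    ContinuousOn (fun t => T t x) (Ici 0) :=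
  (hT.continuous_comp continuous_id (continuous_const (y := x))).continuousOn.congr fun t ht => by
    simp [max_eq_left (mem_Ici.1 ht)]

theorem continuousOn_convolution (hT : IsC0Semigroup T) {h : ℝ → X} {t : ℝ}
    (hh : ContinuousOn h (Icc 0 t)) : ContinuousOn (fun s => T (t - s) (h s)) (Icc 0 t) := by
  have : ContinuousOn (fun s => T (max (t - s) 0) (h s)) (Icc 0 t) :=
    hT.continuous_uncurry.comp_continuousOn
      ((continuous_const.sub continuous_id).continuousOn.prodMk hh)
  exact this.congr fun s hs => by simp [max_eq_left (sub_nonneg.2 hs.2)]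

end IsC0Semigroup

/-! ### Generators and variation of constants -/

section

variable {X : Type*} [NormedAddCommGroup X] [NormedSpace ℝ X]

/-- The pair `(x, y)` belongs to the graph of the infinitesimal generator of `T`. -/
def InGeneratorGraph (T : ℝ → X →L[ℝ] X) (x y : X) : Prop :=
  Tendsto (fun t : ℝ => t⁻¹ • (T t x - x)) (𝓝[>] 0) (𝓝 y)

/-- The generator graph is invariant under the semigroup. -/
theorem InGeneratorGraph.apply {T : ℝ → X →L[ℝ] X} (hT : IsC0Semigroup T) {x y : X}
    (h : InGeneratorGraph T x y) {s : ℝ} (hs : 0 ≤ s) : InGeneratorGraph T (T s x) (T s y) := by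
  have h1 := ((T s).continuous.tendsto y).comp h
  refine h1.congr' ?_
  filter_upwards [self_mem_nhdsWithin] with t ht
  have ht : 0 ≤ t := (mem_Ioi.1 ht).le
  simp only [Function.comp, map_smul, map_sub]
  rw [← hT.map_add_apply hs ht, ← hT.map_add_apply ht hs, add_comm]

theorem tendsto_sub_nhdsGT (s : ℝ) : Tendsto (fun r : ℝ => r - s) (𝓝[>] s) (𝓝[>] 0) := by
  refine tendsto_nhdsWithin_iff.2 ⟨?_, ?_⟩
  · have : Tendsto (fun r : ℝ => r - s) (𝓝 s) (𝓝 (s - s)) :=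
      (continuous_id.sub continuous_const).tendsto s
    rw [sub_self] at this
    exact this.mono_left nhdsWithin_le_nhds
  · filter_upwards [self_mem_nhdsWithin] with r hr
    exact sub_pos.2 (mem_Ioi.1 hr)

/-- Orbits starting in the domain of the generator are right differentiable; the one-sided
derivative is all that the fundamental theorem of calculus needs below. -/
theorem InGeneratorGraph.hasDerivWithinAt {T : ℝ → X →L[ℝ] X} (hT : IsC0Semigroup T) {x y : X}
    (h : InGeneratorGraph T x y) {s : ℝ} (hs : 0 ≤ s) :
    HasDerivWithinAt (fun t => T t x) (T s y) (Ioi s) s := by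
  rw [hasDerivWithinAt_iff_tendsto_slope' self_notMem_Ioi]
  refine ((h.apply hT hs).comp (tendsto_sub_nhdsGT s)).congr' ?_
  filter_upwards [self_mem_nhdsWithin] with r hr
  have hr : s ≤ r := (mem_Ioi.1 hr).le
  rw [slope_def_module, Function.comp, ← hT.map_add_apply (sub_nonneg.2 hr) hs, sub_add_cancel]

/-- Fubini's theorem on the triangle `0 ≤ σ ≤ s ≤ t`. -/
theorem integral_integral_triangle_swap {F : ℝ → ℝ → X} (hF : Continuous (Function.uncurry F))
    {t : ℝ} (ht : 0 ≤ t) :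
    ∫ s in (0 : ℝ)..t, ∫ σ in (0 : ℝ)..s, F s σ = ∫ σ in (0 : ℝ)..t, ∫ s in σ..t, F s σ := by
  set G : ℝ → ℝ → X := fun s σ => {p : ℝ × ℝ | p.2 ≤ p.1}.indicator (Function.uncurry F) (s, σ)
    with hG
  have hmeas : MeasurableSet {p : ℝ × ℝ | p.2 ≤ p.1} :=
    measurableSet_le measurable_snd measurable_fst
  have hint : MeasureTheory.Integrable (Function.uncurry G)
      ((MeasureTheory.volume.restrict (Ioc 0 t)).prod
        (MeasureTheory.volume.restrict (Ioc 0 t))) := by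
    have : Function.uncurry G = {p : ℝ × ℝ | p.2 ≤ p.1}.indicator (Function.uncurry F) := by
      ext ⟨s, σ⟩; rfl
    rw [this, MeasureTheory.Measure.prod_restrict]
    refine MeasureTheory.Integrable.indicator ?_ hmeas
    exact (hF.continuousOn.integrableOn_compact (isCompact_Icc.prod isCompact_Icc)).mono_set
      (prod_mono Ioc_subset_Icc_self Ioc_subset_Icc_self)
  have hswap := MeasureTheory.integral_integral_swap hint
  rw [intervalIntegral.integral_of_le ht, intervalIntegral.integral_of_le ht]
  have e1 : ∫ s in Ioc 0 t, ∫ σ in (0 : ℝ)..s, F s σ = ∫ s in Ioc 0 t, ∫ σ in Ioc 0 t, G s σ := by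
    refine MeasureTheory.setIntegral_congr_fun measurableSet_Ioc fun s hs => ?_
    rw [intervalIntegral.integral_of_le hs.1.le]
    have : G s = (Iic s).indicator (F s) := by
      ext σ; simp [hG, indicator, Function.uncurry]
    rw [this, MeasureTheory.setIntegral_indicator measurableSet_Iic, Ioc_inter_Iic,
      min_eq_right hs.2]
  have e2 : ∫ σ in Ioc 0 t, ∫ s in σ..t, F s σ = ∫ σ in Ioc 0 t, ∫ s in Ioc 0 t, G s σ := by
    refine MeasureTheory.setIntegral_congr_fun measurableSet_Ioc fun σ hσ => ?_
    rw [intervalIntegral.integral_of_le hσ.2, ← MeasureTheory.integral_Icc_eq_integral_Ioc]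
    have : (fun s => G s σ) = (Ici σ).indicator (fun s => F s σ) := by
      ext s; simp [hG, indicator, Function.uncurry]
    rw [this, MeasureTheory.setIntegral_indicator measurableSet_Ici]
    congr 2
    ext s
    simp only [mem_Icc, mem_inter_iff, mem_Ioc, mem_Ici]
    exact ⟨fun h => ⟨⟨hσ.1.trans_le h.1, h.2⟩, h.1⟩, fun h => ⟨h.2, h.1.2⟩⟩
  rw [e1, e2, hswap]

variable [CompleteSpace X]

/-- A strict solution of an inhomogeneous equation satisfies the variation of constants formula:
if `u` has right derivative `u'` and `A u(s) = v(s)`, where `A` generates `T`, then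
`u(t) = T(t) u(0) + ∫₀ᵗ T(t - s) (u'(s) - v(s)) ds`. -/
theorem integral_convolution_of_strict_solution {T : ℝ → X →L[ℝ] X} (hT : IsC0Semigroup T)
    {t : ℝ} (ht : 0 ≤ t) {u u' v : ℝ → X} (hu : ContinuousOn u (Icc 0 t))
    (hu' : ∀ s ∈ Ioo 0 t, HasDerivWithinAt u (u' s) (Ioi s) s)
    (hv : ∀ s ∈ Ioo 0 t, InGeneratorGraph T (u s) (v s))
    (hw : ContinuousOn (fun s => u' s - v s) (Icc 0 t)) :
    ∫ s in (0 : ℝ)..t, T (t - s) (u' s - v s) = u t - T t (u 0) := by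
  have hint : IntervalIntegrable (fun s => T (t - s) (u' s - v s)) MeasureTheory.volume 0 t :=
    ContinuousOn.intervalIntegrable (by rw [uIcc_of_le ht]; exact hT.continuousOn_convolution hw)
  have h0 : T 0 = ContinuousLinearMap.id ℝ X := hT.map_zero
  have key := intervalIntegral.integral_eq_sub_of_hasDeriv_right_of_le
    (f := fun s => T (t - s) (u s)) ht (hT.continuousOn_convolution hu) ?_ hint
  · simpa [h0] using key
  · intro s hs
    rw [hasDerivWithinAt_iff_tendsto_slope' self_notMem_Ioi]
    have hd := hu' s hs
    rw [hasDerivWithinAt_iff_tendsto_slope' self_notMem_Ioi] at hd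
    have hd2 := hd.sub ((hv s hs).comp (tendsto_sub_nhdsGT s))
    have hτ : Tendsto (fun r : ℝ => t - r) (𝓝[>] s) (𝓝 (t - s)) :=
      ((continuous_const.sub continuous_id).tendsto s).mono_left nhdsWithin_le_nhds
    have h3 := (hT.continuous_uncurry.tendsto (t - s, u' s - v s)).comp (hτ.prodMk_nhds hd2)
    simp only [max_eq_left (sub_nonneg.2 hs.2.le)] at h3
    refine h3.congr' ?_
    filter_upwards [Ioo_mem_nhdsGT hs.2] with r hr
    have e : T (t - s) (u s) = T (t - r) (T (r - s) (u s)) := by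
      rw [← hT.map_add_apply (sub_nonneg.2 hr.2.le) (sub_nonneg.2 hr.1.le), sub_add_sub_cancel]
    simp only [Function.comp, max_eq_left (sub_nonneg.2 hr.2.le), slope_def_module, e]
    rw [← smul_sub, map_smul, ← map_sub, sub_sub_sub_cancel_right]

/-- The domain of the generator is dense: it contains the averages `h⁻¹ ∫₀ʰ T(s) x ds`. -/
theorem dense_generator_domain {T : ℝ → X →L[ℝ] X} (hT : IsC0Semigroup T) :
    Dense {x : X | ∃ y, InGeneratorGraph T x y} := by
  intro x
  have hc : Continuous fun s : ℝ => T (max s 0) x := hT.continuous_comp continuous_id continuous_const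
  set F : ℝ → X := fun t => ∫ s in (0 : ℝ)..t, T (max s 0) x with hF
  have hder : ∀ t, HasDerivAt F (T (max t 0) x) t := fun t =>
    intervalIntegral.integral_hasDerivAt_right (hc.intervalIntegrable _ _)
      (hc.stronglyMeasurableAtFilter _ _) hc.continuousAt
  have hslope : ∀ t, 0 ≤ t → Tendsto (fun k : ℝ => k⁻¹ • (F (t + k) - F t)) (𝓝[>] 0) (𝓝 (T t x)) := by
    intro t ht
    have := (hder t).tendsto_slope_zero_right
    rwa [max_eq_left ht] at this
  have hF0 : F 0 = 0 := intervalIntegral.integral_same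
  have h0 : T 0 x = x := by rw [hT.map_zero]; rfl
  have hmem : ∀ t, 0 ≤ t → InGeneratorGraph T (F t) (T t x - x) := by
    intro t ht
    have h1 := (hslope t ht).sub (hslope 0 le_rfl)
    rw [h0] at h1
    refine h1.congr' ?_
    filter_upwards [self_mem_nhdsWithin] with k hk
    have hk : 0 ≤ k := (mem_Ioi.1 hk).le
    rw [← smul_sub, zero_add, hF0, sub_zero]
    congr 1
    have e1 : T k (F t) = ∫ s in (0 : ℝ)..t, T (max (k + s) 0) x := by
      rw [hF, ← ContinuousLinearMap.intervalIntegral_comp_comm _ (hc.intervalIntegrable _ _)]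
      refine intervalIntegral.integral_congr fun s hs => ?_
      rw [uIcc_of_le ht] at hs
      simp only [max_eq_left hs.1, max_eq_left (add_nonneg hk hs.1)]
      rw [hT.map_add_apply hk hs.1]
    have e2 : T k (F t) = F (t + k) - F k := by
      rw [e1, intervalIntegral.integral_comp_add_left (fun s => T (max s 0) x) k, add_zero,
        add_comm k t, hF, intervalIntegral.integral_interval_sub_left] <;>
      exact hc.intervalIntegrable _ _
    rw [e2]; abel
  have hlim := hslope 0 le_rfl
  rw [h0] at hlim
  refine mem_closure_of_tendsto hlim ?_
  filter_upwards [self_mem_nhdsWithin] with k hk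
  have hk : 0 ≤ k := (mem_Ioi.1 hk).le
  refine ⟨k⁻¹ • (T k x - x), ?_⟩
  rw [zero_add, hF0, sub_zero]
  refine ((hmem k hk).const_smul k⁻¹).congr fun s => ?_
  rw [map_smul, ← smul_sub, smul_comm]

/-- Variation of constants for a bounded perturbation: if `A` generates `T` and `A + B` generates
`U`, then `U(t) x - T(t) x = ∫₀ᵗ T(t - s) B U(s) x ds`. -/
theorem integral_convolution_perturbation {T U : ℝ → X →L[ℝ] X} (hT : IsC0Semigroup T)
    (hU : IsC0Semigroup U) (B : X →L[ℝ] X)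
    (hB : ∀ x y, InGeneratorGraph U x y → InGeneratorGraph T x (y - B x))
    {t : ℝ} (ht : 0 ≤ t) (x : X) :
    ∫ s in (0 : ℝ)..t, T (max (t - s) 0) (B (U (max s 0) x)) = U t x - T t x := by
  have hcont : Continuous fun p : X × ℝ => T (max (t - p.2) 0) (B (U (max p.2 0) p.1)) :=
    hT.continuous_comp (by fun_prop) (B.continuous.comp (hU.continuous_comp continuous_snd
      continuous_fst))
  have hclosed : IsClosed {x : X | ∫ s in (0 : ℝ)..t, T (max (t - s) 0) (B (U (max s 0) x)) =
      U t x - T t x} := by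
    refine isClosed_eq ?_ (by fun_prop)
    exact intervalIntegral.continuous_parametric_intervalIntegral_of_continuous'
      (f := fun (x : X) (s : ℝ) => T (max (t - s) 0) (B (U (max s 0) x))) hcont 0 t
  refine hclosed.closure_subset_iff.2 ?_ (dense_generator_domain hU x)
  rintro x ⟨y, hxy⟩
  have h0 : U 0 x = x := by rw [hU.map_zero]; rfl
  have hsub : Icc 0 t ⊆ Ici (0 : ℝ) := fun s hs => hs.1
  have key := integral_convolution_of_strict_solution hT ht (u := fun s => U s x)
    (u' := fun s => U s y) (v := fun s => U s y - B (U s x))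
    ((hU.continuousOn_apply x).mono hsub)
    (fun s hs => hxy.hasDerivWithinAt hU hs.1.le)
    (fun s hs => hB _ _ (hxy.apply hU hs.1.le))
    (by
      simp only [sub_sub_cancel]
      exact B.continuous.comp_continuousOn ((hU.continuousOn_apply x).mono hsub))
  simp only [sub_sub_cancel, h0] at key
  rw [mem_ofPred_eq, ← key]
  refine intervalIntegral.integral_congr fun s hs => ?_
  rw [uIcc_of_le ht] at hs
  simp only [max_eq_left hs.1, max_eq_left (sub_nonneg.2 hs.2)]

end

/-! ### Convolution estimates, uniqueness and change of reference semigroup -/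

section

variable {X : Type*} [NormedAddCommGroup X] [NormedSpace ℝ X]

theorem integral_convolution_eq_cutoff (T : ℝ → X →L[ℝ] X) (h : ℝ → X) {t : ℝ} (ht : 0 ≤ t) :
    ∫ s in (0 : ℝ)..t, T (t - s) (h s) = ∫ s in (0 : ℝ)..t, T (max (t - s) 0) (h s) := by
  refine intervalIntegral.integral_congr fun s hs => ?_
  rw [uIcc_of_le ht] at hs
  simp only [max_eq_left (sub_nonneg.2 hs.2)]

/-- A convolution with a semigroup of growth rate `ω` inherits any growth rate `γ > ω` of the
forcing term. -/
theorem norm_integral_convolution_le {U : ℝ → X →L[ℝ] X} {M ω γ k t : ℝ}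
    (hU : ∀ t, 0 ≤ t → ‖U t‖ ≤ M * Real.exp (ω * t)) (hM : 0 ≤ M) (hγ : ω < γ) (hk : 0 ≤ k)
    (ht : 0 ≤ t) {h : ℝ → X} (hh : ∀ s ∈ Icc 0 t, ‖h s‖ ≤ k * Real.exp (γ * s)) :
    ‖∫ s in (0 : ℝ)..t, U (t - s) (h s)‖ ≤ M * k / (γ - ω) * Real.exp (γ * t) := by
  have hpos : 0 < γ - ω := sub_pos.2 hγ
  have hint : ∫ s in (0 : ℝ)..t, M * k * Real.exp (ω * t) * Real.exp ((γ - ω) * s) =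
      M * k * Real.exp (ω * t) * ((Real.exp ((γ - ω) * t) - 1) / (γ - ω)) := by
    rw [intervalIntegral.integral_const_mul,
      intervalIntegral.integral_comp_mul_left (fun x => Real.exp x) hpos.ne', integral_exp,
      mul_zero, Real.exp_zero, smul_eq_mul, inv_mul_eq_div]
  calc ‖∫ s in (0 : ℝ)..t, U (t - s) (h s)‖
      ≤ ∫ s in (0 : ℝ)..t, M * k * Real.exp (ω * t) * Real.exp ((γ - ω) * s) := by
        refine intervalIntegral.norm_integral_le_of_norm_le ht ?_
          (Continuous.intervalIntegrable (by fun_prop) _ _)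
        refine Eventually.of_forall fun s hs => ?_
        calc ‖U (t - s) (h s)‖ ≤ ‖U (t - s)‖ * ‖h s‖ := ContinuousLinearMap.le_opNorm _ _
          _ ≤ (M * Real.exp (ω * (t - s))) * (k * Real.exp (γ * s)) := by
            gcongr
            · exact hU _ (sub_nonneg.2 hs.2)
            · exact hh s ⟨hs.1.le, hs.2⟩
          _ = M * k * (Real.exp (ω * (t - s)) * Real.exp (γ * s)) := by ring
          _ = M * k * (Real.exp (ω * t) * Real.exp ((γ - ω) * s)) := by
            rw [← Real.exp_add, ← Real.exp_add]; ring_nf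
          _ = _ := by ring
    _ = M * k * Real.exp (ω * t) * ((Real.exp ((γ - ω) * t) - 1) / (γ - ω)) := hint
    _ ≤ M * k * Real.exp (ω * t) * (Real.exp ((γ - ω) * t) / (γ - ω)) := by
        gcongr; linarith
    _ = M * k / (γ - ω) * (Real.exp (ω * t) * Real.exp ((γ - ω) * t)) := by ring
    _ = M * k / (γ - ω) * Real.exp (γ * t) := by
        rw [← Real.exp_add]; ring_nf

/-- Grönwall's inequality in integral form, for a vanishing initial value. -/
theorem eq_zero_of_le_mul_integral {u : ℝ → ℝ} {b C : ℝ} (hu : ContinuousOn u (Icc 0 b))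
    (hu0 : ∀ t ∈ Icc 0 b, 0 ≤ u t)
    (hle : ∀ t ∈ Icc 0 b, u t ≤ C * ∫ s in (0 : ℝ)..t, u s) : ∀ t ∈ Icc 0 b, u t = 0 := by
  intro t ht
  have hb : 0 ≤ b := ht.1.trans ht.2
  -- a continuous extension of `u`, so that its primitive is differentiable everywhere
  set v : ℝ → ℝ := fun t => u (max 0 (min t b)) with hv
  have hmem : ∀ t, max 0 (min t b) ∈ Icc 0 b := fun t =>
    ⟨le_max_left _ _, max_le hb (min_le_right _ _)⟩
  have hvc : Continuous v := hu.comp_continuous (by fun_prop) hmem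
  have hvu : ∀ t ∈ Icc 0 b, v t = u t := fun t ht => by
    simp only [hv, min_eq_left ht.2, max_eq_right ht.1]
  have hint : ∀ t ∈ Icc 0 b, ∫ s in (0 : ℝ)..t, v s = ∫ s in (0 : ℝ)..t, u s := fun t ht => by
    refine intervalIntegral.integral_congr fun s hs => hvu s ?_
    rw [uIcc_of_le ht.1] at hs
    exact ⟨hs.1, hs.2.trans ht.2⟩
  set F : ℝ → ℝ := fun t => ∫ s in (0 : ℝ)..t, v s with hF
  have hder : ∀ t, HasDerivAt F (v t) t := fun t =>
    intervalIntegral.integral_hasDerivAt_right (hvc.intervalIntegrable _ _)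
      (hvc.stronglyMeasurableAtFilter _ _) hvc.continuousAt
  have hF0 : ∀ t ∈ Icc 0 b, 0 ≤ F t := fun t ht =>
    intervalIntegral.integral_nonneg ht.1 fun s _ => hu0 _ (hmem s)
  have key := norm_le_gronwallBound_of_norm_deriv_right_le (f := F) (f' := v) (δ := 0) (K := C)
    (ε := 0) (a := 0) (b := b) (fun t _ => (hder t).continuousAt.continuousWithinAt)
    (fun t _ => (hder t).hasDerivWithinAt) (by simp [hF]) (fun t ht => by
      have ht' : t ∈ Icc 0 b := ⟨ht.1, ht.2.le⟩
      rw [Real.norm_of_nonneg (hu0 _ (hmem t)), Real.norm_of_nonneg (hF0 t ht'), add_zero]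
      change v t ≤ C * ∫ s in (0 : ℝ)..t, v s
      rw [hvu t ht', hint t ht']
      exact hle t ht')
  have hFt : F t = 0 := by
    have := key t ht
    rw [gronwallBound_ε0_δ0] at this
    exact norm_le_zero_iff.1 this
  refine le_antisymm ((hle t ht).trans ?_) (hu0 t ht)
  rw [← hint t ht]
  change C * F t ≤ 0
  rw [hFt, mul_zero]

theorem IsMildSolutionOn.mono {T : ℝ → X →L[ℝ] X} {f : X → X} {b b' : ℝ} {z₀ : X} {z : ℝ → X}
    (h : IsMildSolutionOn T f b z₀ z) (hb : b' ≤ b) : IsMildSolutionOn T f b' z₀ z :=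
  ⟨h.1.mono (Icc_subset_Icc_right hb), fun t ht => h.2 t ⟨ht.1, ht.2.trans hb⟩⟩

variable [CompleteSpace X]

/-- Two mild solutions that stay in a region where the nonlinearity is Lipschitz coincide. -/
theorem IsMildSolutionOn.eqOn_of_lipschitz {T : ℝ → X →L[ℝ] X} (hT : IsC0Semigroup T)
    {f : X → X} (hf : Continuous f) {V : Set X} {L : ℝ}
    (hLip : ∀ x ∈ V, ∀ y ∈ V, ‖f x - f y‖ ≤ L * ‖x - y‖) {b : ℝ} {z₀ : X} {w z : ℝ → X}
    (hw : IsMildSolutionOn T f b z₀ w) (hz : IsMildSolutionOn T f b z₀ z)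
    (hwV : ∀ t ∈ Icc 0 b, w t ∈ V) (hzV : ∀ t ∈ Icc 0 b, z t ∈ V) : EqOn w z (Icc 0 b) := by
  obtain ⟨M, ω, hM, hω, hMω⟩ := hT.exists_norm_le_mul_exp
  have hcont : ContinuousOn (fun t => ‖w t - z t‖) (Icc 0 b) := (hw.1.sub hz.1).norm
  have key := eq_zero_of_le_mul_integral (u := fun t => ‖w t - z t‖) (b := b)
    (C := M * Real.exp (ω * b) * L) hcont (fun _ _ => norm_nonneg _) ?_
  · exact fun t ht => sub_eq_zero.1 (norm_eq_zero.1 (key t ht))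
  intro t ht
  have hsub : Icc 0 t ⊆ Icc 0 b := Icc_subset_Icc_right ht.2
  have hint : ∀ u : ℝ → X, ContinuousOn u (Icc 0 b) →
      IntervalIntegrable (fun s => T (t - s) (f (u s))) MeasureTheory.volume 0 t := fun u hu =>
    ContinuousOn.intervalIntegrable (by
      rw [uIcc_of_le ht.1]
      exact hT.continuousOn_convolution (hf.comp_continuousOn (hu.mono hsub)))
  have e : w t - z t = ∫ s in (0 : ℝ)..t, (T (t - s) (f (w s)) - T (t - s) (f (z s))) := by
    rw [hw.2 t ht, hz.2 t ht, intervalIntegral.integral_sub (hint w hw.1) (hint z hz.1)]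
    abel
  rw [e, ← intervalIntegral.integral_const_mul]
  refine intervalIntegral.norm_integral_le_of_norm_le ht.1 ?_ ?_
  · refine Eventually.of_forall fun s hs => ?_
    have hs' : s ∈ Icc 0 b := ⟨hs.1.le, hs.2.trans ht.2⟩
    rw [← map_sub]
    refine (ContinuousLinearMap.le_opNorm _ _).trans ?_
    rw [mul_assoc]
    gcongr
    · refine (hMω _ (sub_nonneg.2 hs.2)).trans ?_
      gcongr
      linarith [hs.1, ht.2]
    · exact hLip _ (hwV s hs') _ (hzV s hs')
  · refine ContinuousOn.intervalIntegrable ?_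
    rw [uIcc_of_le ht.1]
    exact continuousOn_const.mul (hcont.mono hsub)

/-- A mild solution that stays well inside a ball on which the nonlinearity is Lipschitz is unique
among all mild solutions: a competitor agrees with it up to its first exit from the ball, and so
it never exits. -/
theorem IsMildSolutionOn.eqOn {T : ℝ → X →L[ℝ] X} (hT : IsC0Semigroup T)
    {f : X → X} (hf : Continuous f) {p : X} {ρ L : ℝ}
    (hLip : ∀ x y, ‖x - p‖ ≤ ρ → ‖y - p‖ ≤ ρ → ‖f x - f y‖ ≤ L * ‖x - y‖)
    {b : ℝ} {z₀ : X} {w z : ℝ → X}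
    (hw : IsMildSolutionOn T f b z₀ w) (hz : IsMildSolutionOn T f b z₀ z)
    (hzV : ∀ t ∈ Icc 0 b, ‖z t - p‖ < ρ) : EqOn w z (Icc 0 b) := by
  have hball : ∀ b' ≤ b, (∀ t ∈ Icc 0 b', ‖w t - p‖ ≤ ρ) → EqOn w z (Icc 0 b') := fun b' hb' h =>
    IsMildSolutionOn.eqOn_of_lipschitz hT hf (V := {x | ‖x - p‖ ≤ ρ})
      (fun x hx y hy => hLip x y hx hy) (hw.mono hb') (hz.mono hb') h
      fun t ht => (hzV t ⟨ht.1, ht.2.trans hb'⟩).le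
  by_cases hall : ∀ t ∈ Icc 0 b, ‖w t - p‖ ≤ ρ
  · exact hball b le_rfl hall
  exfalso
  push Not at hall
  obtain ⟨t, ht, hwt⟩ := hall
  have hb : 0 ≤ b := ht.1.trans ht.2
  have hcont : ContinuousOn (fun t => ‖w t - p‖) (Icc 0 b) := (hw.1.sub continuousOn_const).norm
  have hw0 : ‖w 0 - p‖ < ρ := by
    have h0 : (0 : ℝ) ∈ Icc 0 b := ⟨le_rfl, hb⟩
    have : w 0 = z 0 := by rw [hw.2 0 h0, hz.2 0 h0]; simp
    rw [this]
    exact hzV 0 h0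
  have hivt : ∀ s ∈ Icc 0 b, ρ < ‖w s - p‖ → ∃ e ∈ Icc 0 s, ‖w e - p‖ = ρ := fun s hs hws =>
    intermediate_value_Icc hs.1 (hcont.mono (Icc_subset_Icc_right hs.2)) ⟨hw0.le, hws.le⟩
  set E : Set ℝ := Icc 0 b ∩ (fun t => ‖w t - p‖) ⁻¹' {ρ} with hE
  have hEc : IsCompact E :=
    isCompact_Icc.of_isClosed_subset (hcont.preimage_isClosed_of_isClosed isClosed_Icc
      isClosed_singleton) inter_subset_left
  obtain ⟨e, he, hwe⟩ := hivt t ht hwt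
  obtain ⟨t₁, ⟨ht₁, hwt₁⟩, hleast⟩ := hEc.exists_isLeast ⟨e, ⟨he.1, he.2.trans ht.2⟩, hwe⟩
  have hwt₁ : ‖w t₁ - p‖ = ρ := hwt₁
  have heq := hball t₁ ht₁.2 fun s hs => by
    by_contra! hlt
    obtain ⟨e, he, hwe⟩ := hivt s ⟨hs.1, hs.2.trans ht₁.2⟩ hlt
    have h1 : t₁ ≤ e := hleast ⟨⟨he.1, he.2.trans (hs.2.trans ht₁.2)⟩, hwe⟩
    have h2 : s = t₁ := le_antisymm hs.2 (h1.trans he.2)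
    rw [h2, hwt₁] at hlt
    exact lt_irrefl _ hlt
  have h3 := hzV t₁ ht₁
  rw [← heq ⟨ht₁.1, le_rfl⟩, hwt₁] at h3
  exact lt_irrefl _ h3

/-- Change of reference semigroup: a mild solution with respect to the semigroup generated by
`A + B` and forcing `h` is one with respect to the semigroup generated by `A`, with `B x` moved
to the forcing term. -/
theorem mild_of_perturbed_mild {T U : ℝ → X →L[ℝ] X} (hT : IsC0Semigroup T)
    (hU : IsC0Semigroup U) (B : X →L[ℝ] X)
    (hB : ∀ x y, InGeneratorGraph U x y → InGeneratorGraph T x (y - B x))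
    {h x : ℝ → X} (hh : Continuous h) {x₀ : X} {t : ℝ} (ht : 0 ≤ t)
    (hx : ∀ s ∈ Icc 0 t, x s = U s x₀ + ∫ σ in (0 : ℝ)..s, U (s - σ) (h σ)) :
    x t = T t x₀ + ∫ s in (0 : ℝ)..t, T (t - s) (B (x s) + h s) := by
  set F : ℝ → ℝ → X := fun s σ => T (max (t - s) 0) (B (U (max (s - σ) 0) (h σ))) with hF
  have hFc : Continuous (Function.uncurry F) :=
    hT.continuous_comp (τ := fun p : ℝ × ℝ => t - p.1)
      (h := fun p : ℝ × ℝ => B (U (max (p.1 - p.2) 0) (h p.2))) (by fun_prop)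
      (B.continuous.comp (hU.continuous_comp (by fun_prop) (by fun_prop)))
  have hUh : Continuous fun p : ℝ × ℝ => U (max (p.1 - p.2) 0) (h p.2) :=
    hU.continuous_comp (by fun_prop) (by fun_prop)
  have hUt : Continuous fun σ : ℝ => U (max (t - σ) 0) (h σ) :=
    hU.continuous_comp (by fun_prop) (by fun_prop)
  have hTt : Continuous fun σ : ℝ => T (max (t - σ) 0) (h σ) :=
    hT.continuous_comp (by fun_prop) (by fun_prop)
  have hTBU : Continuous fun s : ℝ => T (max (t - s) 0) (B (U (max s 0) x₀)) :=
    hT.continuous_comp (by fun_prop) (B.continuous.comp (hU.continuous_comp continuous_id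
      continuous_const))
  have hFs : Continuous fun s : ℝ => ∫ σ in (0 : ℝ)..s, F s σ :=
    intervalIntegral.continuous_parametric_intervalIntegral_of_continuous hFc continuous_id
  -- the inner integral over `σ ≤ s ≤ t` is again an instance of variation of constants
  have hinner : ∀ σ ∈ Icc 0 t, ∫ s in σ..t, F s σ =
      U (max (t - σ) 0) (h σ) - T (max (t - σ) 0) (h σ) := by
    intro σ hσ
    rw [max_eq_left (sub_nonneg.2 hσ.2),
      ← integral_convolution_perturbation hT hU B hB (sub_nonneg.2 hσ.2) (h σ)]
    have := intervalIntegral.integral_comp_add_right (a := 0) (b := t - σ) (fun s => F s σ) σ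
    rw [zero_add, sub_add_cancel] at this
    rw [← this]
    refine intervalIntegral.integral_congr fun r _ => ?_
    simp only [hF, add_sub_cancel_right]
    rw [show t - (r + σ) = t - σ - r by ring]
  have hdouble : ∫ s in (0 : ℝ)..t, ∫ σ in (0 : ℝ)..s, F s σ =
      (∫ s in (0 : ℝ)..t, U (max (t - s) 0) (h s)) - ∫ s in (0 : ℝ)..t, T (max (t - s) 0) (h s) := by
    rw [integral_integral_triangle_swap hFc ht,
      ← intervalIntegral.integral_sub (hUt.intervalIntegrable _ _) (hTt.intervalIntegrable _ _)]
    refine intervalIntegral.integral_congr fun σ hσ => hinner σ ?_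
    rwa [uIcc_of_le ht] at hσ
  have hsplit : ∫ s in (0 : ℝ)..t, T (t - s) (B (x s) + h s) =
      ∫ s in (0 : ℝ)..t, (T (max (t - s) 0) (B (U (max s 0) x₀)) + (∫ σ in (0 : ℝ)..s, F s σ) +
        T (max (t - s) 0) (h s)) := by
    refine intervalIntegral.integral_congr fun s hs => ?_
    rw [uIcc_of_le ht] at hs
    rw [hx s hs, integral_convolution_eq_cutoff U h hs.1, map_add, map_add, map_add,
      max_eq_left (sub_nonneg.2 hs.2), max_eq_left hs.1]
    congr 2
    have hi : IntervalIntegrable (fun σ => U (max (s - σ) 0) (h σ)) MeasureTheory.volume 0 s :=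
      (hUh.comp (Continuous.prodMk_right s)).intervalIntegrable _ _
    have hi' : IntervalIntegrable (fun σ => B (U (max (s - σ) 0) (h σ)))
        MeasureTheory.volume 0 s :=
      (B.continuous.comp (hUh.comp (Continuous.prodMk_right s))).intervalIntegrable _ _
    rw [← ContinuousLinearMap.intervalIntegral_comp_comm _ hi,
      ← ContinuousLinearMap.intervalIntegral_comp_comm _ hi']
    simp only [hF, max_eq_left (sub_nonneg.2 hs.2)]
  have hTBUF : Continuous fun s : ℝ => T (max (t - s) 0) (B (U (max s 0) x₀)) +
      ∫ σ in (0 : ℝ)..s, F s σ := hTBU.add hFs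
  rw [hsplit, intervalIntegral.integral_add (hTBUF.intervalIntegrable _ _)
    (hTt.intervalIntegrable _ _), intervalIntegral.integral_add (hTBU.intervalIntegrable _ _)
    (hFs.intervalIntegrable _ _), hdouble, integral_convolution_perturbation hT hU B hB ht,
    hx t ⟨ht, le_rfl⟩, integral_convolution_eq_cutoff U h ht]
  abel

end

/-! ### Small solutions of the linearized equation -/

open scoped BoundedContinuousFunction

section

variable {X : Type*} [NormedAddCommGroup X] [NormedSpace ℝ X]

/-- The data of a semilinear equation `ż = A z + f(z)` near an equilibrium `p`, in semigroup form:
`T` is generated by `A` and `U` by `A + B`, where `B` is the derivative of `f` at `p`; the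
remainder of the linearization is of second order on the ball of radius `ρ` around `p`. -/
structure IsLinearizedAt (T U : ℝ → X →L[ℝ] X) (B : X →L[ℝ] X) (f : X → X) (p : X) (ρ K : ℝ) :
    Prop where
  isC0_left : IsC0Semigroup T
  isC0_right : IsC0Semigroup U
  perturbation : ∀ x y, InGeneratorGraph U x y → InGeneratorGraph T x (y - B x)
  continuous : Continuous f
  equilibrium : InGeneratorGraph T p (-f p)
  radius_pos : 0 < ρ
  const_nonneg : 0 ≤ K
  remainder_le : ∀ R ≤ ρ, ∀ x y, ‖x‖ ≤ R → ‖y‖ ≤ R →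
    ‖f (p + x) - f (p + y) - B (x - y)‖ ≤ K * R * ‖x - y‖

variable [CompleteSpace X]

/-- Existence of small solutions of `x(t) = U(t) x₀ + ∫₀ᵗ U(t - s) g(x(s)) ds` for a remainder `g`
of second order, following the linear evolution `U(t) x₀` at a rate `β` with `ω < 2 β`, where `ω` is
a growth rate of `U`. The solution is the fixed point of a contraction in the sup norm with weight
`exp (β (t - n))`; the square of the weight absorbs `exp (ω t)`, and the weight is at most `1` on the
range of times considered. That range, `[0, b]` or `[0, ∞)`, is encoded by a retraction
`τ` of the real line onto it. -/
theorem exists_small_fixedPoint {U : ℝ → X →L[ℝ] X} (hU : IsC0Semigroup U)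
    {M ω β n a ρ K : ℝ} (hM : 0 ≤ M) (hMω : ∀ t, 0 ≤ t → ‖U t‖ ≤ M * Real.exp (ω * t))
    (hβ : ω < 2 * β) {g : X → X} (hgc : Continuous g) (hg0 : g 0 = 0) (hK : 0 ≤ K)
    (hg : ∀ R ≤ ρ, ∀ x y, ‖x‖ ≤ R → ‖y‖ ≤ R → ‖g x - g y‖ ≤ K * R * ‖x - y‖)
    {τ : ℝ → ℝ} (hτc : Continuous τ) (hτ0 : ∀ t, 0 ≤ τ t)
    (hτ : ∀ t s, 0 ≤ s → s ≤ τ t → τ s = s) (hφ : ∀ t, β * (τ t - n) ≤ 0)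
    (ha : 0 ≤ a) (haρ : 2 * a ≤ ρ) (hq : 8 * a * K * M ≤ 2 * β - ω) {x₀ : X}
    (hx₀ : ∀ t, ‖U (τ t) x₀‖ ≤ a * Real.exp (β * (τ t - n))) :
    ∃ x : ℝ → X, Continuous x ∧
      (∀ t, 0 ≤ t → τ t = t → x t = U t x₀ + ∫ s in (0 : ℝ)..t, U (t - s) (g (x s))) ∧
      ∀ t, τ t = t → ‖x t‖ ≤ 2 * a * Real.exp (β * (t - n)) ∧
        ‖x t - U t x₀‖ ≤ a / 2 * Real.exp (β * (t - n)) := by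
  set P : ℝ → ℝ := fun t => Real.exp (β * (τ t - n)) with hP
  have hPc : Continuous P := by fun_prop
  have hPpos : ∀ t, 0 < P t := fun t => Real.exp_pos _
  have hP1 : ∀ t, P t ≤ 1 := fun t => Real.exp_le_one_iff.2 (hφ t)
  have hPs : ∀ t s, 0 ≤ s → s ≤ τ t → P s = Real.exp (β * (s - n)) := fun t s hs hst => by
    simp only [hP, hτ t s hs hst]
  have hpos : 0 < 2 * β - ω := by linarith
  -- `J` is the convolution term at `x = P • y`, so that `y` ranges over bounded functions
  set J : (ℝ → X) → ℝ → X := fun y t =>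
    ∫ s in (0 : ℝ)..τ t, U (max (τ t - s) 0) (g (P s • y s)) with hJ
  have hint : ∀ {y : ℝ → X}, Continuous y → ∀ t, Continuous fun s =>
      U (max (τ t - s) 0) (g (P s • y s)) := fun hy t =>
    hU.continuous_comp (by fun_prop) (by fun_prop)
  have hJc : ∀ {y : ℝ → X}, Continuous y → Continuous (J y) := fun {y} hy =>
    intervalIntegral.continuous_parametric_intervalIntegral_of_continuous
      (f := fun t s => U (max (τ t - s) 0) (g (P s • y s)))
      (hU.continuous_comp (τ := fun p : ℝ × ℝ => τ p.1 - p.2)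
        (h := fun p : ℝ × ℝ => g (P p.2 • y p.2)) (by fun_prop) (by fun_prop)) hτc
  have hJle : ∀ {y y' : ℝ → X} {d : ℝ}, Continuous y → Continuous y' → 0 ≤ d →
      (∀ s, ‖y s‖ ≤ 2 * a) → (∀ s, ‖y' s‖ ≤ 2 * a) → (∀ s, ‖y s - y' s‖ ≤ d) →
      ∀ t, ‖J y t - J y' t‖ ≤ d / 4 * P t := by
    intro y y' d hy hy' hd hya hya' hyd t
    have e : J y t - J y' t =
        ∫ s in (0 : ℝ)..τ t, U (τ t - s) (g (P s • y s) - g (P s • y' s)) := by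
      rw [integral_convolution_eq_cutoff U (fun s => g (P s • y s) - g (P s • y' s)) (hτ0 t)]
      simp only [hJ, map_sub]
      rw [intervalIntegral.integral_sub ((hint hy t).intervalIntegrable _ _)
        ((hint hy' t).intervalIntegrable _ _)]
    rw [e]
    have hsmall : ∀ (y : ℝ → X), (∀ s, ‖y s‖ ≤ 2 * a) → ∀ s, ‖P s • y s‖ ≤ P s * (2 * a) := by
      intro y hya s
      rw [norm_smul, Real.norm_of_nonneg (hPpos s).le]
      exact mul_le_mul_of_nonneg_left (hya s) (hPpos s).le
    refine (norm_integral_convolution_le (γ := 2 * β)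
      (k := K * (2 * a) * d * Real.exp (-(2 * β * n))) hMω hM hβ (by positivity) (hτ0 t) ?_).trans ?_
    · intro s hs
      have hR : P s * (2 * a) ≤ ρ :=
        (mul_le_of_le_one_left (by positivity) (hP1 s)).trans haρ
      refine (hg _ hR _ _ (hsmall y hya s) (hsmall y' hya' s)).trans ?_
      rw [← smul_sub, norm_smul, Real.norm_of_nonneg (hPpos s).le]
      calc K * (P s * (2 * a)) * (P s * ‖y s - y' s‖)
          ≤ K * (P s * (2 * a)) * (P s * d) := by
            have := (hPpos s).le
            gcongr
            exact hyd s
        _ = K * (2 * a) * d * (P s * P s) := by ring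
        _ = K * (2 * a) * d * Real.exp (-(2 * β * n)) * Real.exp (2 * β * s) := by
            rw [hPs t s hs.1 hs.2, mul_assoc _ (Real.exp _), ← Real.exp_add, ← Real.exp_add]
            ring_nf
    · have e2 : Real.exp (-(2 * β * n)) * Real.exp (2 * β * τ t) = P t * P t := by
        simp only [hP]
        rw [← Real.exp_add, ← Real.exp_add]
        ring_nf
      calc M * (K * (2 * a) * d * Real.exp (-(2 * β * n))) / (2 * β - ω) * Real.exp (2 * β * τ t)
          = (8 * a * K * M) / (2 * β - ω) * (d / 4) *
              (Real.exp (-(2 * β * n)) * Real.exp (2 * β * τ t)) := by ring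
        _ = (8 * a * K * M) / (2 * β - ω) * (d / 4) * (P t * P t) := by rw [e2]
        _ ≤ 1 * (d / 4) * (1 * P t) := by
            have := (hPpos t).le
            gcongr
            · exact (div_le_one hpos).2 hq
            · exact hP1 t
        _ = d / 4 * P t := by ring
  have hJ0 : ∀ t, J 0 t = 0 := fun t => by simp [hJ, hg0]
  have hJnorm : ∀ {y : ℝ → X}, Continuous y → (∀ s, ‖y s‖ ≤ 2 * a) → ∀ t,
      ‖J y t‖ ≤ a / 2 * P t := fun {y} hy hya t => by
    have := hJle hy continuous_zero (d := 2 * a) (by positivity) hya (fun s => by simpa using ha)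
      (fun s => by simpa using hya s) t
    rw [hJ0, sub_zero] at this
    linarith
  set Φ : (ℝ → X) → ℝ → X := fun y t => (P t)⁻¹ • (U (max (τ t) 0) x₀ + J y t) with hΦ
  have hΦc : ∀ {y : ℝ → X}, Continuous y → Continuous (Φ y) := fun hy =>
    (hPc.inv₀ fun t => (hPpos t).ne').smul
      ((hU.continuous_comp hτc continuous_const).add (hJc hy))
  have hΦle : ∀ {y : ℝ → X}, Continuous y → (∀ s, ‖y s‖ ≤ 2 * a) → ∀ t, ‖Φ y t‖ ≤ 2 * a := by
    intro y hy hya t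
    rw [norm_smul, norm_inv, Real.norm_of_nonneg (hPpos t).le, inv_mul_le_iff₀ (hPpos t)]
    have h1 := hx₀ t
    rw [← max_eq_left (hτ0 t), max_eq_left (hτ0 t)] at h1
    have h2 := hJnorm hy hya t
    have h3 := norm_add_le (U (max (τ t) 0) x₀) (J y t)
    rw [max_eq_left (hτ0 t)] at h3 ⊢
    have h4 : 0 ≤ a * P t := mul_nonneg ha (hPpos t).le
    change _ ≤ a * P t at h1
    nlinarith
  let S : Set (ℝ →ᵇ X) := {y | ∀ t, ‖y t‖ ≤ 2 * a}
  have hSclosed : IsClosed S := by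
    simp only [S, ofPred_forall]
    exact isClosed_iInter fun t => isClosed_le
      (continuous_eval_const t).norm continuous_const
  have : CompleteSpace S := hSclosed.completeSpace_coe
  have : Nonempty S := ⟨⟨0, fun t => by simpa using ha⟩⟩
  let Ψ : S → S := fun y =>
    ⟨BoundedContinuousFunction.ofNormedAddCommGroup (Φ y.1) (hΦc y.1.continuous) (2 * a)
      (hΦle y.1.continuous y.2), hΦle y.1.continuous y.2⟩
  have hΨ : ContractingWith (1 / 4 : ℝ≥0) Ψ := by
    refine ⟨by rw [← NNReal.coe_lt_coe]; norm_num, LipschitzWith.of_dist_le_mul fun y y' => ?_⟩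
    rw [Subtype.dist_eq, Subtype.dist_eq, BoundedContinuousFunction.dist_le (by positivity)]
    intro t
    have h1 := hJle y.1.continuous y'.1.continuous (d := dist y.1 y'.1) dist_nonneg y.2 y'.2
      (fun s => by rw [← dist_eq_norm]; exact BoundedContinuousFunction.dist_coe_le_dist s) t
    change dist (Φ y.1 t) (Φ y'.1 t) ≤ _
    rw [dist_eq_norm, hΦ, ← smul_sub, add_sub_add_left_eq_sub, norm_smul, norm_inv,
      Real.norm_of_nonneg (hPpos t).le, inv_mul_le_iff₀ (hPpos t)]
    refine h1.trans (le_of_eq ?_)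
    push_cast
    ring
  obtain ⟨y, hy⟩ : ∃ y : S, Ψ y = y := ⟨_, hΨ.fixedPoint_isFixedPt⟩
  have hyfix : ∀ t, P t • y.1 t = U (τ t) x₀ + J y.1 t := fun t => by
    have h1 : Φ y.1 t = y.1 t := congrArg (fun u : S => u.1 t) hy
    rw [← h1, hΦ, smul_inv_smul₀ (hPpos t).ne', max_eq_left (hτ0 t)]
  refine ⟨fun t => P t • y.1 t, hPc.smul y.1.continuous, fun t ht hτt => ?_, fun t hτt => ?_⟩
  · change P t • y.1 t = _
    rw [integral_convolution_eq_cutoff U (fun s => g (P s • y.1 s)) ht, hyfix t, hJ]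
    simp only [hτt]
  · have hPt : P t = Real.exp (β * (t - n)) := by simp only [hP, hτt]
    rw [← hPt]
    constructor
    · change ‖P t • y.1 t‖ ≤ _
      rw [norm_smul, Real.norm_of_nonneg (hPpos t).le, mul_comm]
      exact mul_le_mul_of_nonneg_right (y.2 t) (hPpos t).le
    · change ‖P t • y.1 t - U t x₀‖ ≤ _
      rw [hyfix t, hτt, add_sub_cancel_left]
      exact hJnorm y.1.continuous y.2 t

/-- If the semigroup grows faster than `exp (β t)`, there are arbitrarily large times `n` and
vectors `v` whose orbit, seen backwards from time `n`, decays at the rate `β`. The time `n` is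
a maximum point of `‖U(t) v‖ exp (-β t)` on an interval at whose end this quantity is large. This
replaces the choice of an approximate eigenvector. -/
theorem IsC0Semigroup.exists_orbit_le {U : ℝ → X →L[ℝ] X} (hU : IsC0Semigroup U) {β : ℝ}
    (hβ : 0 ≤ β) (hgrow : ¬ ∃ M : ℝ, ∀ t, 0 ≤ t → ‖U t‖ ≤ M * Real.exp (β * t)) (R : ℝ)
    (hR : 0 ≤ R) :
    ∃ n, 0 ≤ n ∧ ∃ v : X, ‖v‖ ≤ 1 ∧ R < ‖U n v‖ ∧
      ∀ t ∈ Icc 0 n, ‖U t v‖ ≤ ‖U n v‖ * Real.exp (β * (t - n)) := by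
  push Not at hgrow
  obtain ⟨N, hN, hRN⟩ := hgrow R
  obtain ⟨v, hv, hRv⟩ : ∃ v : X, ‖v‖ ≤ 1 ∧ R * Real.exp (β * N) < ‖U N v‖ := by
    by_contra! hcon
    refine absurd (ContinuousLinearMap.opNorm_le_of_unit_norm (by positivity) fun x hx => ?_)
      (not_le.2 hRN)
    exact hcon x hx.le
  set q : ℝ → ℝ := fun t => ‖U t v‖ * Real.exp (-(β * t)) with hq
  have hqc : ContinuousOn q (Icc 0 N) :=
    (((hU.continuousOn_apply v).mono fun s hs => hs.1).norm).mul (by fun_prop)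
  obtain ⟨n, hn, hmax⟩ := isCompact_Icc.exists_isMaxOn (nonempty_Icc.2 hN) hqc
  have hqN : R < q N := by
    simp only [hq]
    rw [Real.exp_neg, ← div_eq_mul_inv, lt_div_iff₀ (Real.exp_pos _)]
    exact hRv
  have hle : ∀ t ∈ Icc 0 N, q t ≤ q n := fun t ht => hmax ht
  refine ⟨n, hn.1, v, hv, ?_, fun t ht => ?_⟩
  · refine (hqN.trans_le (hle N ⟨hN, le_rfl⟩)).trans_le ?_
    refine mul_le_of_le_one_right (norm_nonneg _) (Real.exp_le_one_iff.2 ?_)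
    have := mul_nonneg hβ hn.1
    linarith
  · have h1 := hle t ⟨ht.1, ht.2.trans hn.2⟩
    simp only [hq] at h1
    have h2 : ‖U t v‖ = ‖U t v‖ * Real.exp (-(β * t)) * Real.exp (β * t) := by
      rw [mul_assoc, ← Real.exp_add, neg_add_cancel, Real.exp_zero, mul_one]
    rw [h2]
    refine (mul_le_mul_of_nonneg_right h1 (Real.exp_pos _).le).trans (le_of_eq ?_)
    rw [mul_assoc, ← Real.exp_add]
    ring_nf

/-- A positive growth bound `ω₀` admits rates `β < ω₀ < ω` with `ω < 2 β`. -/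
theorem IsC0Semigroup.exists_rates {U : ℝ → X →L[ℝ] X} (hU : IsC0Semigroup U)
    (h : IsUnstableSemigroup U) : ∃ β ω M : ℝ, 0 < β ∧ ω < 2 * β ∧ 0 ≤ M ∧
      (∀ t, 0 ≤ t → ‖U t‖ ≤ M * Real.exp (ω * t)) ∧
      ¬ ∃ M : ℝ, ∀ t, 0 ≤ t → ‖U t‖ ≤ M * Real.exp (β * t) := by
  set S : Set ℝ := {ω : ℝ | ∃ M : ℝ, ∀ t : ℝ, 0 ≤ t → ‖U t‖ ≤ M * Real.exp (ω * t)} with hS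
  have hne : S.Nonempty := by
    obtain ⟨M, ω, -, -, hM⟩ := hU.exists_norm_le_mul_exp
    exact ⟨ω, M, hM⟩
  obtain ⟨w, hw0, hw⟩ := EReal.lt_iff_exists_real_btwn.1 h
  have hw0 : 0 < w := by exact_mod_cast hw0
  have hlb : ∀ ω ∈ S, w ≤ ω := fun ω hω => by
    have : (w : EReal) ≤ ω := hw.le.trans (sInf_le ⟨ω, hω, rfl⟩)
    exact_mod_cast this
  have hinf : w ≤ sInf S := le_csInf hne hlb
  obtain ⟨ω, hω, hlt⟩ := exists_lt_of_csInf_lt hne (b := 5 / 4 * sInf S) (by linarith)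
  obtain ⟨M, hM⟩ := hω
  refine ⟨3 / 4 * sInf S, ω, max M 0, by linarith, by linarith, le_max_right _ _,
    fun t ht => (hM t ht).trans (by gcongr; exact le_max_left _ _), fun hβ => ?_⟩
  have : sInf S ≤ 3 / 4 * sInf S := csInf_le ⟨w, hlb⟩ hβ
  linarith

namespace IsLinearizedAt

variable {T U : ℝ → X →L[ℝ] X} {B : X →L[ℝ] X} {f : X → X} {p : X} {ρ K : ℝ}

theorem eqOn (h : IsLinearizedAt T U B f p ρ K) {b : ℝ} {z₀ : X} {w z : ℝ → X}
    (hw : IsMildSolutionOn T f b z₀ w) (hz : IsMildSolutionOn T f b z₀ z)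
    (hzV : ∀ t ∈ Icc 0 b, ‖z t - p‖ < ρ) : EqOn w z (Icc 0 b) := by
  refine IsMildSolutionOn.eqOn h.isC0_left h.continuous (L := K * ρ + ‖B‖) ?_ hw hz hzV
  intro x y hx hy
  have h1 := h.remainder_le ρ le_rfl (x - p) (y - p) hx hy
  rw [add_sub_cancel, add_sub_cancel, sub_sub_sub_cancel_right] at h1
  have h2 := B.le_opNorm (x - y)
  have h3 := norm_add_le (f x - f y - B (x - y)) (B (x - y))
  rw [sub_add_cancel] at h3
  linarith

/-- Mild solutions near the equilibrium that follow the linear orbit `U(t) x₀` within half of its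
amplitude `a exp (β (t - n))`. The retraction `τ` encodes the range of times, as in
`exists_small_fixedPoint`. -/
theorem exists_solution (h : IsLinearizedAt T U B f p ρ K)
    {M ω β n a : ℝ} (hM : 0 ≤ M) (hMω : ∀ t, 0 ≤ t → ‖U t‖ ≤ M * Real.exp (ω * t))
    (hβ : ω < 2 * β) {τ : ℝ → ℝ} (hτc : Continuous τ) (hτ0 : ∀ t, 0 ≤ τ t)
    (hτ : ∀ t s, 0 ≤ s → s ≤ τ t → τ s = s) (hφ : ∀ t, β * (τ t - n) ≤ 0)
    (ha : 0 ≤ a) (haρ : 2 * a ≤ ρ) (hq : 8 * a * K * M ≤ 2 * β - ω) {x₀ : X}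
    (hx₀ : ∀ t, ‖U (τ t) x₀‖ ≤ a * Real.exp (β * (τ t - n))) :
    ∃ z : ℝ → X, (∀ b, τ b = b → IsMildSolutionOn T f b (p + x₀) z) ∧
      ∀ t, τ t = t → ‖z t - p‖ ≤ 2 * a * Real.exp (β * (t - n)) ∧
        ‖z t - p - U t x₀‖ ≤ a / 2 * Real.exp (β * (t - n)) := by
  set g : X → X := fun x => f (p + x) - f p - B x with hg
  have hfc := h.continuous
  have hgc : Continuous g := by fun_prop
  obtain ⟨x, hxc, hx, hxle⟩ := exists_small_fixedPoint h.isC0_right hM hMω hβ hgc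
    (by simp [hg]) h.const_nonneg (ρ := ρ) (fun R hR x y hxR hyR => by
      have := h.remainder_le R hR x y hxR hyR
      rw [map_sub] at this
      simp only [hg]
      convert this using 2
      abel) hτc hτ0 hτ hφ ha haρ hq hx₀
  refine ⟨fun t => p + x t, fun b hb => ⟨by fun_prop, fun t ht => ?_⟩, fun t ht => by
    simpa using hxle t ht⟩
  have hT := h.isC0_left
  have hx' : ∀ s ∈ Icc 0 t, x s = U s x₀ + ∫ σ in (0 : ℝ)..s, U (s - σ) (g (x σ)) := fun s hs =>
    hx s hs.1 (hτ b s hs.1 (by rw [hb]; exact hs.2.trans ht.2))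
  have h1 := mild_of_perturbed_mild hT h.isC0_right B h.perturbation (hgc.comp hxc) ht.1 hx'
  have h2 := integral_convolution_of_strict_solution hT ht.1 (u := fun _ => p) (u' := fun _ => 0)
    (v := fun _ => -f p) continuousOn_const (fun s _ => hasDerivWithinAt_const _ _ _)
    (fun _ _ => h.equilibrium) continuousOn_const
  have hint : ∀ u : ℝ → X, Continuous u →
      IntervalIntegrable (fun s => T (t - s) (u s)) MeasureTheory.volume 0 t := fun u hu =>
    ContinuousOn.intervalIntegrable (by
      rw [uIcc_of_le ht.1]
      exact hT.continuousOn_convolution hu.continuousOn)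
  simp only [zero_sub, neg_neg] at h2
  have h3 : ∫ s in (0 : ℝ)..t, T (t - s) (f (p + x s)) =
      (∫ s in (0 : ℝ)..t, T (t - s) (B (x s) + (g ∘ x) s)) + ∫ s in (0 : ℝ)..t, T (t - s) (f p) := by
    rw [← intervalIntegral.integral_add (hint (fun s => B (x s) + (g ∘ x) s) (by fun_prop))
      (hint _ continuous_const)]
    refine intervalIntegral.integral_congr fun s _ => ?_
    simp only [← map_add, hg, Function.comp]
    congr 1
    abel
  simp only
  rw [h3, h2, map_add]
  nth_rewrite 1 [h1]
  abel

theorem isLocallyExponentiallyStable (h : IsLinearizedAt T U B f p ρ K)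
    (hU : IsExponentiallyStable U) : IsLocallyExponentiallyStable T f p := by
  obtain ⟨M₀, α, hα, hM₀⟩ := hU
  set M := max M₀ 1 with hM
  have hM1 : 1 ≤ M := le_max_right _ _
  have hMp : 0 < M := by linarith
  have hMα : ∀ t, 0 ≤ t → ‖U t‖ ≤ M * Real.exp (-α * t) := fun t ht =>
    (hM₀ t ht).trans (by gcongr; exact le_max_left _ _)
  have hK := h.const_nonneg
  have hρ := h.radius_pos
  refine ⟨min (ρ / (4 * M)) (α / (16 * K * M ^ 2 + 1)), 2 * M, α / 4, by positivity, by positivity,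
    fun z₀ hz₀ => ?_⟩
  set x₀ := z₀ - p with hx₀
  have hd1 : ‖x₀‖ * (4 * M) < ρ := (lt_div_iff₀ (by positivity)).1 (hz₀.trans_le (min_le_left _ _))
  have hd2 : ‖x₀‖ * (16 * K * M ^ 2 + 1) < α :=
    (lt_div_iff₀ (by positivity)).1 (hz₀.trans_le (min_le_right _ _))
  have hx0 := norm_nonneg x₀
  -- the rate `-α / 4` leaves the gap `2 * (-α / 4) - (-α) = α / 2`
  obtain ⟨z, hz, hzle⟩ := h.exists_solution (β := -α / 4) (n := 0) (a := M * ‖x₀‖)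
    (τ := fun t => max t 0) (x₀ := x₀) hMp.le hMα (by linarith) (by fun_prop)
    (fun t => le_max_right _ _) (fun t s hs _ => max_eq_left hs)
    (fun t => by have := le_max_right t 0; nlinarith) (by positivity) (by nlinarith)
    (by nlinarith) (fun t => by
      have h0 : 0 ≤ max t 0 := le_max_right _ _
      refine (ContinuousLinearMap.le_opNorm _ _).trans ?_
      calc ‖U (max t 0)‖ * ‖x₀‖ ≤ M * Real.exp (-α * max t 0) * ‖x₀‖ := by
            gcongr; exact hMα _ h0
        _ = M * ‖x₀‖ * Real.exp (-α * max t 0) := by ring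
        _ ≤ M * ‖x₀‖ * Real.exp (-α / 4 * (max t 0 - 0)) := by
            refine mul_le_mul_of_nonneg_left (Real.exp_le_exp.2 ?_) (by positivity)
            nlinarith)
  have hpx : p + x₀ = z₀ := by rw [hx₀]; abel
  rw [hpx] at hz
  have hz' : ∀ b, IsMildSolutionOn T f b z₀ z := fun b =>
    (hz (max b 0) (max_eq_left (le_max_right _ _))).mono (le_max_left _ _)
  refine ⟨z, hz', fun b w hw => h.eqOn hw (hz' b) fun t ht => ?_, fun t ht => ?_⟩
  · have h1 := (hzle t (max_eq_left ht.1)).1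
    have h2 : Real.exp (-α / 4 * (t - 0)) ≤ 1 := Real.exp_le_one_iff.2 (by nlinarith [ht.1])
    have h3 : 2 * (M * ‖x₀‖) * Real.exp (-α / 4 * (t - 0)) ≤ 2 * (M * ‖x₀‖) * 1 := by gcongr
    nlinarith
  · refine (hzle t (max_eq_left ht)).1.trans (le_of_eq ?_)
    rw [sub_zero, neg_div]
    ring

theorem isUnstableEquilibrium (h : IsLinearizedAt T U B f p ρ K)
    (hU : IsUnstableSemigroup U) : IsUnstableEquilibrium T f p := by
  obtain ⟨β, ω, M, hβ, hωβ, hM, hMω, hgrow⟩ := h.isC0_right.exists_rates hU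
  have hK := h.const_nonneg
  have hρ := h.radius_pos
  have hgap : 0 < 2 * β - ω := by linarith
  -- the amplitude reached by the linear orbit: small, but independent of the initial distance
  obtain ⟨a, ha, haρ, hq⟩ : ∃ a : ℝ, 0 < a ∧ 2 * a ≤ ρ ∧ 8 * a * K * M ≤ 2 * β - ω := by
    have hKM : 0 ≤ K * M := mul_nonneg hK hM
    refine ⟨min (ρ / 2) ((2 * β - ω) / (8 * (K * M) + 1)), by positivity, ?_, ?_⟩
    · linarith [min_le_left (ρ / 2) ((2 * β - ω) / (8 * (K * M) + 1))]
    · have h1 := (le_div_iff₀ (by positivity)).1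
        (min_le_right (ρ / 2) ((2 * β - ω) / (8 * (K * M) + 1)))
      have h2 : 0 < min (ρ / 2) ((2 * β - ω) / (8 * (K * M) + 1)) := by positivity
      nlinarith
  refine ⟨a / 2, by positivity, fun δ hδ => ?_⟩
  obtain ⟨n, hn, v, hv, hRv, hle⟩ := h.isC0_right.exists_orbit_le hβ.le hgrow (a / δ)
    (by positivity)
  have hvpos : 0 < ‖U n v‖ := lt_of_le_of_lt (by positivity) hRv
  set x₀ : X := (a / ‖U n v‖) • v with hx₀
  have hnorm : ∀ t, ‖U t x₀‖ = a / ‖U n v‖ * ‖U t v‖ := fun t => by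
    rw [hx₀, map_smul, norm_smul, Real.norm_of_nonneg (by positivity)]
  have hτmem : ∀ t, max 0 (min t n) ∈ Icc 0 n := fun t =>
    ⟨le_max_left _ _, max_le hn (min_le_right _ _)⟩
  have hτn : max 0 (min n n) = n := by simp [hn]
  obtain ⟨z, hz, hzle⟩ := h.exists_solution (β := β) (n := n) (a := a)
    (τ := fun t => max 0 (min t n)) (x₀ := x₀) hM hMω hωβ (by fun_prop)
    (fun t => (hτmem t).1) (fun t s hs hst => by
      rw [min_eq_left (hst.trans (hτmem t).2), max_eq_right hs])
    (fun t => mul_nonpos_of_nonneg_of_nonpos hβ.le (sub_nonpos.2 (hτmem t).2)) ha.le haρ hq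
    (fun t => by
      rw [hnorm]
      refine (mul_le_mul_of_nonneg_left (hle _ (hτmem t)) (by positivity)).trans (le_of_eq ?_)
      field_simp)
  refine ⟨p + x₀, ?_, n, z, hn, hz n hτn, ?_⟩
  · rw [add_sub_cancel_left, hx₀, norm_smul, Real.norm_of_nonneg (by positivity)]
    refine (mul_le_of_le_one_right (by positivity) hv).trans_lt ?_
    rw [div_lt_iff₀ hvpos]
    rw [div_lt_iff₀ hδ] at hRv
    linarith
  · have h1 := (hzle n hτn).2
    rw [sub_self, mul_zero, Real.exp_zero, mul_one] at h1
    have h2 : ‖U n x₀‖ = a := by rw [hnorm]; field_simp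
    have h3 := norm_sub_norm_le (U n x₀) (U n x₀ - (z n - p))
    rw [sub_sub_cancel, norm_sub_rev (U n x₀)] at h3
    linarith

end IsLinearizedAt

end

/-! ### Reduction to real scalars -/

section RestrictScalars

variable {𝕜 X : Type*} [RCLike 𝕜] [NormedAddCommGroup X] [NormedSpace ℝ X] [NormedSpace 𝕜 X]

/-- A function whose derivative is Lipschitz on the ball of radius `r` has second order remainder at
an interior point of that ball. -/
theorem norm_linearization_remainder_le {f : X → X} (hf : Differentiable 𝕜 f) {p : X} {r K : ℝ}
    (hK : 0 ≤ K) (hp : ‖p‖ ≤ r)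
    (hLip : ∀ z₁ z₂ : X, ‖z₁‖ ≤ r → ‖z₂‖ ≤ r →
      ‖fderiv 𝕜 f z₁ - fderiv 𝕜 f z₂‖ ≤ K * ‖z₁ - z₂‖) {R : ℝ} (hR : R ≤ r - ‖p‖) {x y : X}
    (hx : ‖x‖ ≤ R) (hy : ‖y‖ ≤ R) :
    ‖f (p + x) - f (p + y) - fderiv 𝕜 f p (x - y)‖ ≤ K * R * ‖x - y‖ := by
  have hmem : ∀ x : X, ‖x‖ ≤ R → p + x ∈ Metric.closedBall p R := fun x hx => by
    simpa [mem_closedBall_iff_norm] using hx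
  have := (convex_closedBall p R).norm_image_sub_le_of_norm_hasFDerivWithin_le' (𝕜 := 𝕜)
    (f := f) (f' := fderiv 𝕜 f) (φ := fderiv 𝕜 f p) (C := K * R)
    (fun z _ => (hf z).hasFDerivAt.hasFDerivWithinAt) (fun z hz => ?_) (hmem y hy) (hmem x hx)
  · simpa using this
  · rw [mem_closedBall_iff_norm] at hz
    have h1 : ‖z‖ ≤ r := by
      have := norm_add_le (z - p) p
      rw [sub_add_cancel] at this
      linarith
    exact (hLip z p h1 hp).trans (mul_le_mul_of_nonneg_left hz hK)

variable [IsScalarTower ℝ 𝕜 X]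

theorem IsC0Semigroup.restrictScalars {T : ℝ → X →L[𝕜] X} (hT : IsC0Semigroup T) :
    IsC0Semigroup fun t => (T t).restrictScalars ℝ where
  map_zero := by rw [hT.map_zero]; rfl
  map_add s t hs ht := by rw [hT.map_add s t hs ht]; rfl
  tendsto_zero := hT.tendsto_zero

theorem growthBound_restrictScalars (U : ℝ → X →L[𝕜] X) :
    growthBound (fun t => (U t).restrictScalars ℝ) = growthBound U := by
  simp only [growthBound, ContinuousLinearMap.norm_restrictScalars]

theorem GeneratesC0Semigroup.inGeneratorGraph_of_linearizedOperator {A : X →ₗ.[𝕜] X}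
    {T U : ℝ → X →L[𝕜] X} {f : X → X} {p : X} (hA : GeneratesC0Semigroup A T)
    (hU : GeneratesC0Semigroup (linearizedOperator A f p) U) {x y : X}
    (hxy : InGeneratorGraph (fun t => (U t).restrictScalars ℝ) x y) :
    InGeneratorGraph (fun t => (T t).restrictScalars ℝ) x (y - fderiv 𝕜 f p x) := by
  have hmem := (hU.mem_graph_iff x y).2 hxy
  rw [LinearPMap.mem_graph_iff] at hmem
  obtain ⟨w, hw, hwy⟩ := hmem
  refine (hA.mem_graph_iff x _).1 ((LinearPMap.mem_graph_iff _).2 ⟨⟨w, w.2⟩, hw, ?_⟩)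
  change (w : X) = x at hw
  change linearizedOperator A f p w = y at hwy
  subst hw hwy
  exact (add_sub_cancel_left (fderiv 𝕜 f p w) (A ⟨w, w.2⟩)).symm

/-- The hypotheses on generators and derivatives, in semigroup form over the reals. -/
theorem GeneratesC0Semigroup.isLinearizedAt {A : X →ₗ.[𝕜] X}
    {T U : ℝ → X →L[𝕜] X} (hA : GeneratesC0Semigroup A T) {f : X → X} (hf : Differentiable 𝕜 f)
    {p : X} (hp : IsEquilibrium A f p) {r K : ℝ} (hK : 0 ≤ K) (hr : ‖p‖ < r)
    (hLip : ∀ z₁ z₂ : X, ‖z₁‖ ≤ r → ‖z₂‖ ≤ r →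
      ‖fderiv 𝕜 f z₁ - fderiv 𝕜 f z₂‖ ≤ K * ‖z₁ - z₂‖)
    (hU : GeneratesC0Semigroup (linearizedOperator A f p) U) :
    IsLinearizedAt (fun t => (T t).restrictScalars ℝ) (fun t => (U t).restrictScalars ℝ)
      ((fderiv 𝕜 f p).restrictScalars ℝ) f p (r - ‖p‖) K where
  isC0_left := hA.isC0Semigroup.restrictScalars
  isC0_right := hU.isC0Semigroup.restrictScalars
  perturbation _ _ hxy := hA.inGeneratorGraph_of_linearizedOperator hU hxy
  continuous := hf.continuous
  equilibrium := by
    obtain ⟨hpA, hAp⟩ := hp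
    refine (hA.mem_graph_iff p _).1 ((LinearPMap.mem_graph_iff _).2 ⟨⟨p, hpA⟩, rfl, ?_⟩)
    exact eq_neg_of_add_eq_zero_left hAp
  radius_pos := sub_pos.2 hr
  const_nonneg := hK
  remainder_le _ hR _ _ hx hy := norm_linearization_remainder_le hf hK hr.le hLip hR hx hy

end RestrictScalars

theorem theorem3 {𝕜 X : Type*} [RCLike 𝕜] [NormedAddCommGroup X]
    [NormedSpace ℝ X] [NormedSpace 𝕜 X] [IsScalarTower ℝ 𝕜 X] [CompleteSpace X]
    (A : X →ₗ.[𝕜] X) (T : ℝ → X →L[𝕜] X) (hA : GeneratesC0Semigroup A T)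
    (f : X → X) (hf : Differentiable 𝕜 f)
    (z_e : X) (hz_e : IsEquilibrium A f z_e)
    (c : ℝ≥0 → ℝ≥0) (hc_cont : Continuous c) (hc_mono : Monotone c)
    (r : ℝ≥0) (hr : ‖z_e‖ < r)
    (hLip : ∀ z₁ z₂ : X, ‖z₁‖ ≤ r → ‖z₂‖ ≤ r →
      ‖fderiv 𝕜 f z₁ - fderiv 𝕜 f z₂‖ ≤ c r * ‖z₁ - z₂‖) :
    ((∃ U : ℝ → X →L[𝕜] X, GeneratesC0Semigroup (linearizedOperator A f z_e) U ∧
        IsExponentiallyStable U) →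
      IsLocallyExponentiallyStable T f z_e) ∧
    ((∃ U : ℝ → X →L[𝕜] X, GeneratesC0Semigroup (linearizedOperator A f z_e) U ∧
        IsUnstableSemigroup U) →
      IsUnstableEquilibrium T f z_e) := by
  have key : ∀ U : ℝ → X →L[𝕜] X, GeneratesC0Semigroup (linearizedOperator A f z_e) U →
      IsLinearizedAt (fun t => (T t).restrictScalars ℝ) (fun t => (U t).restrictScalars ℝ)
        ((fderiv 𝕜 f z_e).restrictScalars ℝ) f z_e (r - ‖z_e‖) (c r) := fun U hU =>
    hA.isLinearizedAt hf hz_e (c r).coe_nonneg hr hLip hU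
  constructor
  · rintro ⟨U, hU, M, α, hα, hM⟩
    exact (key U hU).isLocallyExponentiallyStable
      ⟨M, α, hα, fun t ht => by simpa using hM t ht⟩
  · rintro ⟨U, hU, hunst⟩
    refine (key U hU).isUnstableEquilibrium ?_
    rwa [IsUnstableSemigroup, growthBound_restrictScalars]
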